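/- Let $a\in\mathbb R$, $b>0$, $\sigma>0$, $v_0\in\mathbb R$ and $V_0=e^{2v_0}$. Let $(w_t)_{t\ge0}$ be a standard real Brownian motion under a probability measure $P$, let $(v_t)_{t\ge0}$ be a solution with continuous paths, started at $v_0$, of $$dv_t=(a-b\,e^{2v_t})\,dt+\sigma\,dw_t ,$$ (the case $\alpha=2$ of the $\alpha$-hypergeometric model), and let $V_t=e^{2v_t}$ be the instantaneous variance. For $t>0$ put $$\textsc{vs}(t)=\frac1t\int_0^t\mathbb E[V_s]\,ds,\qquad f(t)=\frac1{2bt}\ln\Big(1+2bV_0\,\frac{e^{(2a+2\sigma^2)t}-1}{2a+2\sigma^2}\Big),$$ where the last fraction is read as its limiting value $t$ when $a+\sigma^2=0$. Then every $\mathbb E[V_s]$ and the integral $\int_0^t\mathbb E[V_s]\,ds$ are finite, and $$\textsc{vs}(t)<f(t)\qquad\text{for every } t>0 .$$ Moreover, as $t\downarrow0$, $$\textsc{vs}(t)\sim f(t)\sim V_0\big(1+(a+\sigma^2-bV_0)t\big),$$ both in the sense that the ratios tend to $1$ and in the sense of first-order expansions: $\textsc{vs}(t)-f(t)=o(t)$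 and $f(t)-V_0\big(1+(a+\sigma^2-bV_0)t\big)=o(t)$. -/

import Mathlib

open MeasureTheory ProbabilityTheory Filter Topology Asymptotics
open scoped NNReal

namespace AlphaHypergeometric

noncomputable section

/-- `v` is a solution, with continuous paths and deterministic starting point `v₀`, of
`dv_t = (a - b e^{α v_t}) dt + σ dw_t`. The noise is additive, so that the equation is, in integrated
form, the pathwise equation below, which holds simultaneously for all times, almost surely. -/
def IsLogVolSolution {Ω : Type*} [MeasurableSpace Ω] (P : Measure Ω)
    (α a b σ v₀ : ℝ) (w v : ℝ≥0 → Ω → ℝ) : Prop :=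
  ∀ᵐ ω ∂P, Continuous (fun t : ℝ≥0 => v t ω) ∧
    ∀ t : ℝ≥0, v t ω =
      v₀ + (∫ s in (0 : ℝ)..(t : ℝ), (a - b * Real.exp (α * v s.toNNReal ω))) + σ * w t ω

/-- The instantaneous variance `V_t = e^{2 v_t}`. -/
def instVar {Ω : Type*} (v : ℝ≥0 → Ω → ℝ) (t : ℝ≥0) (ω : Ω) : ℝ :=
  Real.exp (2 * v t ω)

/-- `E[V_s]`, as a function of a real time `s` (only used for `s ≥ 0`). -/
def meanVar {Ω : Type*} [MeasurableSpace Ω] (P : Measure Ω) (v : ℝ≥0 → Ω → ℝ) (s : ℝ) : ℝ :=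
  ∫ ω, instVar v s.toNNReal ω ∂P

/-- The variance swap `vs(t) = (1/t) ∫₀ᵗ E[V_s] ds`, for `t > 0`. -/
def varSwap {Ω : Type*} [MeasurableSpace Ω] (P : Measure Ω) (v : ℝ≥0 → Ω → ℝ) (t : ℝ) : ℝ :=
  (1 / t) * ∫ s in (0 : ℝ)..t, meanVar P v s

/-- `(e^{ct} - 1) / c`, with its limiting value `t` for `c = 0`. -/
def expQuot (c t : ℝ) : ℝ :=
  if c = 0 then t else (Real.exp (c * t) - 1) / c

/-- `f(t) = (1/(2bt)) ln (1 + 2 b V₀ (e^{(2a+2σ²)t} - 1)/(2a+2σ²))`, for `t > 0`. -/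
def swapBound (a b σ V₀ t : ℝ) : ℝ :=
  1 / (2 * b * t) * Real.log (1 + 2 * b * V₀ * expQuot (2 * a + 2 * σ ^ 2) t)

/-- The first-order expansion `V₀ (1 + (a + σ² - b V₀) t)`. -/
def firstOrder (a b σ V₀ t : ℝ) : ℝ :=
  V₀ * (1 + (a + σ ^ 2 - b * V₀) * t)

end

end AlphaHypergeometric

/-!
The equation has an explicit pathwise solution. Put `y_s = v₀ + a s + σ w_s` and
`J_t = ∫₀ᵗ e^{2 y_s} ds`. Since `v_t = y_t - b ∫₀ᵗ V`, the function `e^{2b ∫₀ᵗ V}` has derivative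
`2b e^{2 y_t}`, so that `∫₀ᵗ V = ln (1 + 2b J_t) / (2b)` (`IsLogVolSolution.explicit`). Hence
`vs(t) = E[ln (1 + 2b J_t)] / (2bt)` (`IsLogVolSolution.varSwap_eq`), while `f(t)` is
`ln (1 + 2b E[J_t]) / (2bt)` by the Gaussian exponential moments (`expFunctional_mean`). The bound
`vs < f` is therefore Jensen's inequality for the logarithm (`integral_log_one_add_lt`). It is strict
because `J_t` is not almost surely constant: weighting by `e^{w_t}` strictly increases its mean
(`not_expFunctional_ae_eq_mean`). Finiteness follows from `0 < V_s ≤ e^{2 y_s}`.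

For small times, `u - u²/2 ≤ ln (1 + u)` and `E[J_t²] ≤ t ∫₀ᵗ E[e^{4 y_s}] ds` bound `vs` from below
(`IsLogVolSolution.le_varSwap`), and `ln (1 + u) ≤ u - u²/2 + u³/3` bounds `f` from above
(`swapBound_le`). Both bounds have the expansion `V₀ (1 + (a + σ² - b V₀) t) + o(t)`, hence so have
`vs` and `f`, which lie between them (`isLittleO_sub_firstOrder`). As `V₀ ≠ 0`, errors `o(t)` are
relative errors `o(1)`, and this gives the equivalences.
-/

namespace AlphaHypergeometric

/-! ### Joint measurability and Tonelli's theorem for continuous processes -/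

/-- Time discretizations `x ≈ g n (i n x)` with countably many values converge pointwise. -/
lemma exists_discretization : ∃ (g : ℕ → ℕ → ℝ≥0) (i : ℕ → ℝ≥0 → ℕ),
    (∀ n, Measurable (i n)) ∧ ∀ x, Tendsto (fun n => g n (i n x)) atTop (𝓝 x) := by
  refine ⟨fun n k => ((k : ℝ) / n).toNNReal, fun n x => ⌊(x : ℝ) * n⌋₊,
    fun n => Nat.measurable_floor.comp (by fun_prop), fun x => ?_⟩
  have h := (tendsto_nat_floor_mul_div_atTop (R := ℝ) x.coe_nonneg).comp tendsto_natCast_atTop_atTop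
  have h' := (continuous_real_toNNReal.tendsto _).comp h
  rwa [Real.toNNReal_coe] at h'

/-- A process with almost surely continuous paths and measurable marginals is jointly measurable up
to null sets: it is the almost everywhere limit of its time discretizations. -/
lemma aestronglyMeasurable_uncurry_of_continuous {Ω : Type*} [MeasurableSpace Ω] {P : Measure Ω}
    [SFinite P] {X : ℝ≥0 → Ω → ℝ} (hX : ∀ t, AEMeasurable (X t) P)
    (hc : ∀ᵐ ω ∂P, Continuous (fun t => X t ω)) (μ : Measure ℝ) [SFinite μ] :
    AEStronglyMeasurable (fun p : ℝ × Ω => X p.1.toNNReal p.2) (μ.prod P) := by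
  choose Y hYm hY using hX
  obtain ⟨g, i, hi, hgi⟩ := exists_discretization
  have hmeas (n : ℕ) : Measurable (fun p : ℝ × Ω => Y (g n (i n p.1.toNNReal)) p.2) := by
    have h1 : Measurable (fun q : ℕ × Ω => Y (g n q.1) q.2) :=
      measurable_from_prod_countable_right fun k => hYm (g n k)
    exact h1.comp (((hi n).comp (measurable_real_toNNReal.comp measurable_fst)).prodMk
      measurable_snd)
  refine aestronglyMeasurable_of_tendsto_ae atTop (fun n => (hmeas n).aestronglyMeasurable) ?_
  have hgood : ∀ᵐ ω ∂P, Continuous (fun t => X t ω) ∧ ∀ n k, X (g n k) ω = Y (g n k) ω := by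
    filter_upwards [hc, ae_all_iff.2 fun n => ae_all_iff.2 fun k => hY (g n k)]
      with ω h1 h2 using ⟨h1, h2⟩
  filter_upwards [Measure.quasiMeasurePreserving_snd.ae hgood] with p hp
  simp_rw [← hp.2]
  exact (hp.1.tendsto p.1.toNNReal).comp (hgi _)

/-- Tonelli's theorem for a nonnegative process `X` whose mean is a continuous function of time. -/
lemma integrable_prod_of_mean {Ω : Type*} [MeasurableSpace Ω] {P : Measure Ω} [SFinite P]
    {X : ℝ → Ω → ℝ} {h : ℝ → ℝ} {t : ℝ}
    (hm : AEStronglyMeasurable (fun p : ℝ × Ω => X p.1 p.2)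
      ((volume.restrict (Set.Ioc 0 t)).prod P))
    (hpos : ∀ s ω, 0 ≤ X s ω) (hint : ∀ s ∈ Set.Ioc 0 t, Integrable (X s) P)
    (hmean : ∀ s ∈ Set.Ioc 0 t, ∫ ω, X s ω ∂P = h s) (hh : Continuous h) :
    Integrable (fun p : ℝ × Ω => X p.1 p.2) ((volume.restrict (Set.Ioc 0 t)).prod P) := by
  rw [integrable_prod_iff hm]
  refine ⟨(ae_restrict_iff' measurableSet_Ioc).2 (.of_forall hint), ?_⟩
  have hI : Integrable h (volume.restrict (Set.Ioc 0 t)) :=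
    hh.integrableOn_Ioc
  refine hI.congr ((ae_restrict_iff' measurableSet_Ioc).2 (.of_forall fun s hs => ?_))
  simp only [Real.norm_of_nonneg (hpos _ _)]
  exact (hmean s hs).symm

/-- The mean of a time integral is the time integral of the mean. -/
lemma integral_intervalIntegral_swap {Ω : Type*} [MeasurableSpace Ω] {P : Measure Ω} [SFinite P]
    {X : ℝ → Ω → ℝ} {t : ℝ} (ht : 0 ≤ t)
    (hX : Integrable (fun p : ℝ × Ω => X p.1 p.2) ((volume.restrict (Set.Ioc 0 t)).prod P)) :
    Integrable (fun ω => ∫ s in (0 : ℝ)..t, X s ω) P ∧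
      ∫ ω, (∫ s in (0 : ℝ)..t, X s ω) ∂P = ∫ s in (0 : ℝ)..t, (∫ ω, X s ω ∂P) := by
  simp only [intervalIntegral.integral_of_le ht]
  exact ⟨hX.integral_prod_right, (integral_integral_swap hX).symm⟩

/-! ### Brownian motion and the pathwise solution of the equation -/

/-- The two-time exponential moment of Brownian motion. -/
lemma exp_moment {Ω : Type*} [MeasurableSpace Ω] {P : Measure Ω} [IsProbabilityMeasure P]
    {w : ℝ≥0 → Ω → ℝ} (hw : IsPreBrownianReal w P) (p θ : ℝ) {s t : ℝ≥0} (hst : s ≤ t) :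
    Integrable (fun ω => Real.exp (p * w s ω) * Real.exp (θ * w t ω)) P ∧
      ∫ ω, Real.exp (p * w s ω) * Real.exp (θ * w t ω) ∂P =
        Real.exp ((p ^ 2 * s + 2 * p * θ * s + θ ^ 2 * t) / 2) := by
  -- `p w_s + θ w_t = (p + θ) w_s + θ (w_t - w_s)` is a sum of independent Gaussian variables
  have hind : IndepFun (w s) (w t - w s) P :=
    hw.hasIndepIncrements.indepFun_eval_sub zero_le hst hw.eval_zero_ae_eq_zero
  have hind' := hind.comp (φ := fun x => Real.exp ((p + θ) * x))
    (ψ := fun x => Real.exp (θ * x)) (by fun_prop) (by fun_prop)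
  have hv : ((nndist t.1 s.1 : ℝ≥0) : ℝ) = t - s := by
    have : (s : ℝ) ≤ t := hst
    rw [coe_nndist, Real.dist_eq]
    exact abs_of_nonneg (sub_nonneg.2 this)
  have h1 : Integrable (fun ω => Real.exp ((p + θ) * w s ω)) P := by
    have := (hw.hasLaw_eval s).map_eq ▸ integrable_exp_mul_gaussianReal (μ := 0) (v := s) (p + θ)
    exact this.comp_aemeasurable (hw.aemeasurable s)
  have h2 : Integrable (fun ω => Real.exp (θ * (w t - w s) ω)) P := by
    have := (hw.hasLaw_sub t s).map_eq ▸
      integrable_exp_mul_gaussianReal (μ := 0) (v := nndist t.1 s.1) θ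
    exact this.comp_aemeasurable (hw.hasLaw_sub t s).aemeasurable
  have h3 := mgf_gaussianReal (hw.hasLaw_eval s).map_eq (p + θ)
  have h4 := mgf_gaussianReal (hw.hasLaw_sub t s).map_eq θ
  have heq : (fun ω => Real.exp (p * w s ω) * Real.exp (θ * w t ω)) =
      fun ω => Real.exp ((p + θ) * w s ω) * Real.exp (θ * (w t - w s) ω) := by
    funext ω
    rw [← Real.exp_add, ← Real.exp_add, Pi.sub_apply]
    ring_nf
  rw [heq]
  refine ⟨hind'.integrable_mul h1 h2, ?_⟩
  have := hind'.integral_fun_mul_eq_mul_integral h1.aestronglyMeasurable h2.aestronglyMeasurable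
  simp only [Function.comp_apply] at this
  rw [this]
  rw [mgf] at h3 h4
  rw [h3, h4, ← Real.exp_add, hv]
  ring_nf

/-- The logarithmic volatility without the mean-reverting drift, `v₀ + a s + σ w_s`. -/
noncomputable def freeLogVol {Ω : Type*} (a σ v₀ : ℝ) (w : ℝ≥0 → Ω → ℝ) (s : ℝ) (ω : Ω) : ℝ :=
  v₀ + a * s + σ * w s.toNNReal ω

/-- The exponential functional `∫₀ᵗ e^{2 (v₀ + a s + σ w_s)} ds` of Brownian motion. -/
noncomputable def expFunctional {Ω : Type*} (a σ v₀ : ℝ) (w : ℝ≥0 → Ω → ℝ) (t : ℝ) (ω : Ω) : ℝ :=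
  ∫ s in (0 : ℝ)..t, Real.exp (2 * freeLogVol a σ v₀ w s ω)

/-- The equation is solved pathwise: `e^{2b ∫₀ᵗ V}` has derivative
`2b V_t e^{2b ∫₀ᵗ V} = 2b e^{2 (v₀ + a t + σ w_t)}`. -/
lemma exp_integral_eq {a b σ v₀ : ℝ} {w v : ℝ≥0 → ℝ} (hvc : Continuous v)
    (hv : ∀ t : ℝ≥0, v t =
      v₀ + (∫ s in (0 : ℝ)..(t : ℝ), (a - b * Real.exp (2 * v s.toNNReal))) + σ * w t)
    {t : ℝ} (ht : 0 ≤ t) :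
    Real.exp (2 * b * ∫ s in (0 : ℝ)..t, Real.exp (2 * v s.toNNReal)) =
        1 + 2 * b * ∫ s in (0 : ℝ)..t, Real.exp (2 * (v₀ + a * s + σ * w s.toNNReal)) ∧
      v t.toNNReal = v₀ + a * t + σ * w t.toNNReal -
        b * ∫ s in (0 : ℝ)..t, Real.exp (2 * v s.toNNReal) := by
  set g : ℝ → ℝ := fun s => Real.exp (2 * v s.toNNReal) with hg
  have hgc : Continuous g := by fun_prop
  have hv' : ∀ s : ℝ, 0 ≤ s → v s.toNNReal =
      v₀ + a * s + σ * w s.toNNReal - b * ∫ r in (0 : ℝ)..s, g r := by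
    intro s hs
    rw [hv, Real.coe_toNNReal s hs, intervalIntegral.integral_sub
      intervalIntegrable_const ((hgc.const_mul b).intervalIntegrable _ _),
      intervalIntegral.integral_const_mul]
    simp
    ring
  refine ⟨?_, hv' t ht⟩
  have hI (s : ℝ) : HasDerivAt (fun s => ∫ r in (0 : ℝ)..s, g r) (g s) s :=
    intervalIntegral.integral_hasDerivAt_right (hgc.intervalIntegrable _ _)
      (hgc.stronglyMeasurableAtFilter _ _) hgc.continuousAt
  have hIc : Continuous (fun s => ∫ r in (0 : ℝ)..s, g r) :=
    continuous_iff_continuousAt.2 fun s => (hI s).continuousAt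
  have hE (s : ℝ) : HasDerivAt (fun s => Real.exp (2 * b * ∫ r in (0 : ℝ)..s, g r))
      (Real.exp (2 * b * ∫ r in (0 : ℝ)..s, g r) * (2 * b * g s)) s :=
    ((hI s).const_mul (2 * b)).exp
  have hftc := intervalIntegral.integral_eq_sub_of_hasDerivAt (a := 0) (b := t)
    (fun s _ => hE s) (Continuous.intervalIntegrable (by fun_prop) _ _)
  have hcongr : ∫ s in (0 : ℝ)..t, Real.exp (2 * b * ∫ r in (0 : ℝ)..s, g r) * (2 * b * g s) =
      ∫ s in (0 : ℝ)..t, 2 * b * Real.exp (2 * (v₀ + a * s + σ * w s.toNNReal)) := by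
    refine intervalIntegral.integral_congr fun s hs => ?_
    rw [Set.uIcc_of_le ht] at hs
    have h1 : g s = Real.exp (2 * (v₀ + a * s + σ * w s.toNNReal)) *
        Real.exp (-(2 * b * ∫ r in (0 : ℝ)..s, g r)) := by
      rw [← Real.exp_add]
      rw [show g s = Real.exp (2 * v s.toNNReal) from rfl, hv' s hs.1]
      congr 1
      ring
    rw [h1, Real.exp_neg]
    field_simp
  rw [hcongr, intervalIntegral.integral_const_mul] at hftc
  simp only [intervalIntegral.integral_same, mul_zero, Real.exp_zero] at hftc
  linarith

/-! ### Elementary inequalities and expansions -/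

/-- Cauchy–Schwarz for time integrals, against the constant function `1`. -/
lemma sq_intervalIntegral_le {g : ℝ → ℝ} (hg : Continuous g) {t : ℝ} (ht : 0 < t) :
    (∫ s in (0 : ℝ)..t, g s) ^ 2 ≤ t * ∫ s in (0 : ℝ)..t, g s ^ 2 := by
  set J := ∫ s in (0 : ℝ)..t, g s with hJ
  -- the variance of `g` under the uniform law on `[0, t]` is nonnegative
  have h0 : 0 ≤ ∫ s in (0 : ℝ)..t, (g s - J / t) ^ 2 :=
    intervalIntegral.integral_nonneg ht.le fun s _ => sq_nonneg _
  have h1 : ∫ s in (0 : ℝ)..t, (g s - J / t) ^ 2 =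
      (∫ s in (0 : ℝ)..t, g s ^ 2) - J ^ 2 / t := by
    have : ∀ s, (g s - J / t) ^ 2 = g s ^ 2 - 2 * (J / t) * g s + (J / t) ^ 2 := fun s => by ring
    simp_rw [this]
    rw [intervalIntegral.integral_add, intervalIntegral.integral_sub,
      intervalIntegral.integral_const_mul, ← hJ, intervalIntegral.integral_const]
    · simp only [sub_zero, smul_eq_mul]
      field_simp
      ring
    all_goals exact Continuous.intervalIntegrable (by fun_prop) _ _
  rw [h1, sub_nonneg, div_le_iff₀ ht] at h0
  linarith

/-- `(e^{ct} - 1) / c` is the integral of `e^{cs}` over `[0, t]`, also for `c = 0`. -/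
lemma integral_exp_eq_expQuot (c t : ℝ) :
    ∫ s in (0 : ℝ)..t, Real.exp (c * s) = expQuot c t := by
  unfold expQuot
  split_ifs with hc
  · simp [hc]
  · rw [intervalIntegral.integral_comp_mul_left (fun x => Real.exp x) hc, integral_exp]
    simp [div_eq_inv_mul]

/-- The difference of the two sides has derivative `u² / (1 + u)`. -/
lemma log_one_add_ge {u : ℝ} (hu : 0 ≤ u) : u - u ^ 2 / 2 ≤ Real.log (1 + u) := by
  have hd : ∀ x ∈ Set.Ici (0 : ℝ), HasDerivAt (fun x => Real.log (1 + x) - (x - x ^ 2 / 2))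
      (1 / (1 + x) - (1 - x)) x := by
    intro x hx
    have hx' : (1 + x) ≠ 0 := by have : 0 ≤ x := hx; positivity
    have := (((hasDerivAt_id x).const_add 1).log hx').sub
      ((hasDerivAt_id x).sub (((hasDerivAt_id x).pow 2).div_const 2))
    simp only [id] at this
    refine this.congr_deriv ?_
    norm_num
  have hmono : MonotoneOn (fun x => Real.log (1 + x) - (x - x ^ 2 / 2)) (Set.Ici (0 : ℝ)) := by
    refine monotoneOn_of_deriv_nonneg (convex_Ici 0)
      (fun x hx => (hd x hx).continuousAt.continuousWithinAt)
      (fun x hx => (hd x (interior_subset hx)).differentiableAt.differentiableWithinAt)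
      fun x hx => ?_
    have hx0 : 0 ≤ x := interior_subset hx
    rw [(hd x (interior_subset hx)).deriv]
    have : 1 / (1 + x) - (1 - x) = x ^ 2 / (1 + x) := by field_simp; ring
    rw [this]
    positivity
  have := hmono (Set.self_mem_Ici) (show u ∈ Set.Ici 0 from hu) hu
  simp only [add_zero, Real.log_one] at this
  linarith

/-- The difference of the two sides has derivative `u³ / (1 + u)`. -/
lemma log_one_add_le {u : ℝ} (hu : 0 ≤ u) :
    Real.log (1 + u) ≤ u - u ^ 2 / 2 + u ^ 3 / 3 := by
  have hd : ∀ x ∈ Set.Ici (0 : ℝ),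
      HasDerivAt (fun x => (x - x ^ 2 / 2 + x ^ 3 / 3) - Real.log (1 + x))
      ((1 - x + x ^ 2) - 1 / (1 + x)) x := by
    intro x hx
    have hx' : (1 + x) ≠ 0 := by have : 0 ≤ x := hx; positivity
    have := (((hasDerivAt_id x).sub (((hasDerivAt_id x).pow 2).div_const 2)).add
      (((hasDerivAt_id x).pow 3).div_const 3)).sub (((hasDerivAt_id x).const_add 1).log hx')
    simp only [id] at this
    refine this.congr_deriv ?_
    norm_num
  have hmono : MonotoneOn (fun x => (x - x ^ 2 / 2 + x ^ 3 / 3) - Real.log (1 + x))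
      (Set.Ici (0 : ℝ)) := by
    refine monotoneOn_of_deriv_nonneg (convex_Ici 0)
      (fun x hx => (hd x hx).continuousAt.continuousWithinAt)
      (fun x hx => (hd x (interior_subset hx)).differentiableAt.differentiableWithinAt)
      fun x hx => ?_
    have hx0 : 0 ≤ x := interior_subset hx
    rw [(hd x (interior_subset hx)).deriv]
    have : (1 - x + x ^ 2) - 1 / (1 + x) = x ^ 3 / (1 + x) := by field_simp; ring
    rw [this]
    positivity
  have := hmono (Set.self_mem_Ici) (show u ∈ Set.Ici 0 from hu) hu
  simp only [add_zero, Real.log_one] at this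
  norm_num at this
  linarith

/-- Second-order expansion of `(e^{ct} - 1) / c` at `t = 0`. -/
lemma tendsto_expQuot_second (c : ℝ) :
    Tendsto (fun t => (expQuot c t - t) / t ^ 2) (𝓝[>] 0) (𝓝 (c / 2)) := by
  by_cases hc : c = 0
  · simp [expQuot, hc]
  have h := (Real.exp_sub_sum_range_succ_isLittleO_pow 2).tendsto_div_nhds_zero
  have hct : Tendsto (fun t : ℝ => c * t) (𝓝[>] 0) (𝓝 0) := by
    have : Tendsto (fun t : ℝ => c * t) (𝓝 0) (𝓝 (c * 0)) := by
      exact (continuous_const.mul continuous_id).tendsto 0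
    rw [mul_zero] at this
    exact this.mono_left nhdsWithin_le_nhds
  have h2 := ((h.comp hct).const_mul c).add_const (c / 2)
  rw [mul_zero, zero_add] at h2
  refine h2.congr' ?_
  filter_upwards [self_mem_nhdsWithin] with t ht
  have ht' : t ≠ 0 := ne_of_gt ht
  simp only [Function.comp_apply, Finset.sum_range_succ, Finset.sum_range_zero, expQuot, hc,
    if_false]
  norm_num
  field_simp
  ring

lemma tendsto_expQuot_first (c : ℝ) :
    Tendsto (fun t => expQuot c t / t) (𝓝[>] 0) (𝓝 1) := by
  have h0 : Tendsto (fun t : ℝ => t) (𝓝[>] 0) (𝓝 0) := nhdsWithin_le_nhds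
  have h := ((tendsto_expQuot_second c).mul h0).add_const 1
  rw [mul_zero, zero_add] at h
  refine h.congr' ?_
  filter_upwards [self_mem_nhdsWithin] with t ht
  have ht' : t ≠ 0 := ne_of_gt ht
  field_simp
  ring

lemma expQuot_pos (c : ℝ) {t : ℝ} (ht : 0 < t) : 0 < expQuot c t := by
  rw [← integral_exp_eq_expQuot]
  exact intervalIntegral.intervalIntegral_pos_of_pos
    (Continuous.intervalIntegrable (by fun_prop) _ _) (fun _ => Real.exp_pos _) ht

/-! ### Moments of the exponential functional -/

lemma aestronglyMeasurable_freeLogVol {Ω : Type*} [MeasurableSpace Ω] {P : Measure Ω}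
    [IsProbabilityMeasure P] {w : ℝ≥0 → Ω → ℝ} (hw : IsBrownianReal w P) (a σ v₀ : ℝ)
    (μ : Measure ℝ) [SFinite μ] :
    AEStronglyMeasurable (fun q : ℝ × Ω => freeLogVol a σ v₀ w q.1 q.2) (μ.prod P) := by
  have h := aestronglyMeasurable_uncurry_of_continuous hw.aemeasurable hw.cont μ
  have h1 : AEStronglyMeasurable (fun q : ℝ × Ω => v₀ + a * q.1) (μ.prod P) :=
    Measurable.aestronglyMeasurable (by fun_prop)
  exact h1.add (h.const_mul σ)

/-- The exponential moments of `v₀ + a s + σ w_s` jointly with the terminal value `w_t`. -/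
lemma exp_freeLogVol_moment {Ω : Type*} [MeasurableSpace Ω] {P : Measure Ω}
    [IsProbabilityMeasure P] {w : ℝ≥0 → Ω → ℝ} (hw : IsPreBrownianReal w P) (a σ v₀ p θ : ℝ)
    {s t : ℝ} (hs : 0 ≤ s) (hst : s ≤ t) :
    Integrable (fun ω => Real.exp (p * freeLogVol a σ v₀ w s ω) *
        Real.exp (θ * w t.toNNReal ω)) P ∧
      ∫ ω, Real.exp (p * freeLogVol a σ v₀ w s ω) * Real.exp (θ * w t.toNNReal ω) ∂P =
        Real.exp (p * v₀ + θ ^ 2 * t / 2) *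
          Real.exp ((p * a + (p * σ) ^ 2 / 2 + p * σ * θ) * s) := by
  obtain ⟨h1, h2⟩ := exp_moment hw (p * σ) θ (Real.toNNReal_le_toNNReal hst)
  rw [Real.coe_toNNReal s hs, Real.coe_toNNReal t (hs.trans hst)] at h2
  have heq : (fun ω => Real.exp (p * freeLogVol a σ v₀ w s ω) * Real.exp (θ * w t.toNNReal ω)) =
      fun ω => Real.exp (p * (v₀ + a * s)) *
        (Real.exp (p * σ * w s.toNNReal ω) * Real.exp (θ * w t.toNNReal ω)) := by
    funext ω
    rw [← Real.exp_add, ← Real.exp_add, ← Real.exp_add, freeLogVol]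
    ring_nf
  rw [heq]
  refine ⟨h1.const_mul _, ?_⟩
  rw [integral_const_mul, h2, ← Real.exp_add, ← Real.exp_add]
  ring_nf

/-- Time integrals of the exponential moments of `v₀ + a s + σ w_s`, jointly with `w_t`. -/
lemma integral_exp_freeLogVol {Ω : Type*} [MeasurableSpace Ω] {P : Measure Ω}
    [IsProbabilityMeasure P] {w : ℝ≥0 → Ω → ℝ} (hw : IsBrownianReal w P) (a σ v₀ p θ : ℝ)
    {t : ℝ} (ht : 0 ≤ t) :
    Integrable (fun q : ℝ × Ω => Real.exp (p * freeLogVol a σ v₀ w q.1 q.2) *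
        Real.exp (θ * w t.toNNReal q.2)) ((volume.restrict (Set.Ioc 0 t)).prod P) ∧
      Integrable (fun ω => (∫ s in (0 : ℝ)..t, Real.exp (p * freeLogVol a σ v₀ w s ω)) *
        Real.exp (θ * w t.toNNReal ω)) P ∧
      ∫ ω, (∫ s in (0 : ℝ)..t, Real.exp (p * freeLogVol a σ v₀ w s ω)) *
        Real.exp (θ * w t.toNNReal ω) ∂P =
        Real.exp (p * v₀ + θ ^ 2 * t / 2) * expQuot (p * a + (p * σ) ^ 2 / 2 + p * σ * θ) t := by
  have hint : Integrable (fun q : ℝ × Ω => Real.exp (p * freeLogVol a σ v₀ w q.1 q.2) *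
      Real.exp (θ * w t.toNNReal q.2)) ((volume.restrict (Set.Ioc 0 t)).prod P) := by
    refine integrable_prod_of_mean (X := fun s ω => Real.exp (p * freeLogVol a σ v₀ w s ω) *
      Real.exp (θ * w t.toNNReal ω)) (h := fun s => Real.exp (p * v₀ + θ ^ 2 * t / 2) *
      Real.exp ((p * a + (p * σ) ^ 2 / 2 + p * σ * θ) * s)) ?_ (fun s ω => by positivity)
      (fun s hs => (exp_freeLogVol_moment hw.toIsPreBrownianReal a σ v₀ p θ hs.1.le hs.2).1)
      (fun s hs => (exp_freeLogVol_moment hw.toIsPreBrownianReal a σ v₀ p θ hs.1.le hs.2).2)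
      (by fun_prop)
    refine (Real.continuous_exp.comp_aestronglyMeasurable
      ((aestronglyMeasurable_freeLogVol hw a σ v₀ _).const_mul p)).mul ?_
    exact Real.continuous_exp.comp_aestronglyMeasurable
      ((hw.aemeasurable _).aestronglyMeasurable.comp_snd.const_mul θ)
  obtain ⟨h1, h2⟩ := integral_intervalIntegral_swap
    (X := fun s ω => Real.exp (p * freeLogVol a σ v₀ w s ω) * Real.exp (θ * w t.toNNReal ω)) ht hint
  simp only [intervalIntegral.integral_mul_const] at h1 h2
  refine ⟨hint, h1, ?_⟩
  rw [h2, ← integral_exp_eq_expQuot, ← intervalIntegral.integral_const_mul]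
  refine intervalIntegral.integral_congr fun s hs => ?_
  rw [Set.uIcc_of_le ht] at hs
  exact (exp_freeLogVol_moment hw.toIsPreBrownianReal a σ v₀ p θ hs.1 hs.2).2

lemma expFunctional_nonneg {Ω : Type*} (a σ v₀ : ℝ) (w : ℝ≥0 → Ω → ℝ) {t : ℝ} (ht : 0 ≤ t)
    (ω : Ω) : 0 ≤ expFunctional a σ v₀ w t ω :=
  intervalIntegral.integral_nonneg ht fun _ _ => (Real.exp_pos _).le

lemma expFunctional_mean {Ω : Type*} [MeasurableSpace Ω] {P : Measure Ω}
    [IsProbabilityMeasure P] {w : ℝ≥0 → Ω → ℝ} (hw : IsBrownianReal w P) (a σ v₀ : ℝ)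
    {t : ℝ} (ht : 0 ≤ t) :
    Integrable (expFunctional a σ v₀ w t) P ∧
      ∫ ω, expFunctional a σ v₀ w t ω ∂P =
        Real.exp (2 * v₀) * expQuot (2 * a + 2 * σ ^ 2) t := by
  obtain ⟨-, h1, h2⟩ := integral_exp_freeLogVol hw a σ v₀ 2 0 ht
  simp only [zero_mul, Real.exp_zero, mul_one] at h1 h2
  refine ⟨h1, h2.trans ?_⟩
  ring_nf

/-- By Cauchy–Schwarz in time, `(∫₀ᵗ e^{2y})² ≤ t ∫₀ᵗ e^{4y}`, and the mean of the right-hand side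
is explicit. -/
lemma expFunctional_sq_mean_le {Ω : Type*} [MeasurableSpace Ω] {P : Measure Ω}
    [IsProbabilityMeasure P] {w : ℝ≥0 → Ω → ℝ} (hw : IsBrownianReal w P) (a σ v₀ : ℝ)
    {t : ℝ} (ht : 0 < t) :
    Integrable (fun ω => expFunctional a σ v₀ w t ω ^ 2) P ∧
      ∫ ω, expFunctional a σ v₀ w t ω ^ 2 ∂P ≤
        t * (Real.exp (2 * v₀) ^ 2 * expQuot (4 * a + 8 * σ ^ 2) t) := by
  obtain ⟨-, h1, h2⟩ := integral_exp_freeLogVol hw a σ v₀ 4 0 ht.le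
  simp only [zero_mul, Real.exp_zero, mul_one] at h1 h2
  have hle : ∀ᵐ ω ∂P, expFunctional a σ v₀ w t ω ^ 2 ≤
      t * ∫ s in (0 : ℝ)..t, Real.exp (4 * freeLogVol a σ v₀ w s ω) := by
    filter_upwards [hw.cont] with ω hω
    have hc : Continuous fun s => Real.exp (2 * freeLogVol a σ v₀ w s ω) := by
      unfold freeLogVol
      fun_prop
    refine (sq_intervalIntegral_le hc ht).trans_eq ?_
    congr 2
    funext s
    rw [← Real.exp_nat_mul]
    congr 1
    push_cast
    ring
  have hint : Integrable (fun ω => expFunctional a σ v₀ w t ω ^ 2) P := by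
    refine (h1.const_mul t).mono' ((expFunctional_mean hw a σ v₀ ht.le).1.1.pow 2) ?_
    filter_upwards [hle] with ω hω
    rwa [Real.norm_of_nonneg (sq_nonneg _)]
  refine ⟨hint, (integral_mono_ae hint (h1.const_mul t) hle).trans_eq ?_⟩
  rw [integral_const_mul, h2, ← Real.exp_nat_mul]
  push_cast
  ring_nf

/-- The exponential functional is random: if it were almost surely equal to its mean, its
expectation would not change under the tilt by `e^{w_t}`, but this tilt adds the drift `2σ` to the
exponent `2 σ w`. -/
lemma not_expFunctional_ae_eq_mean {Ω : Type*} [MeasurableSpace Ω] {P : Measure Ω}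
    [IsProbabilityMeasure P] {w : ℝ≥0 → Ω → ℝ} (hw : IsBrownianReal w P) (a v₀ : ℝ) {σ : ℝ}
    (hσ : 0 < σ) {t : ℝ} (ht : 0 < t) :
    ¬ ∀ᵐ ω ∂P, expFunctional a σ v₀ w t ω =
      Real.exp (2 * v₀) * expQuot (2 * a + 2 * σ ^ 2) t := by
  intro h
  obtain ⟨-, -, h2⟩ := integral_exp_freeLogVol hw a σ v₀ 2 1 ht.le
  obtain ⟨-, h3⟩ := exp_moment hw.toIsPreBrownianReal 0 1 (le_refl t.toNNReal)
  have h4 : ∫ ω, (∫ s in (0 : ℝ)..t, Real.exp (2 * freeLogVol a σ v₀ w s ω)) *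
        Real.exp (1 * w t.toNNReal ω) ∂P =
      Real.exp (2 * v₀) * expQuot (2 * a + 2 * σ ^ 2) t * Real.exp (t / 2) := by
    rw [Real.coe_toNNReal t ht.le] at h3
    simp only [zero_mul, Real.exp_zero, one_mul] at h3
    rw [show Real.exp (t / 2) = ∫ ω, Real.exp (w t.toNNReal ω) ∂P by rw [h3]; congr 1; ring,
      ← integral_const_mul]
    refine integral_congr_ae ?_
    filter_upwards [h] with ω hω
    rw [← hω, one_mul, expFunctional]
  rw [h4, Real.exp_add] at h2
  have hlt : expQuot (2 * a + 2 * σ ^ 2) t <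
      expQuot (2 * a + (2 * σ) ^ 2 / 2 + 2 * σ * 1) t := by
    rw [← integral_exp_eq_expQuot, ← integral_exp_eq_expQuot]
    refine intervalIntegral.integral_lt_integral_of_continuousOn_of_le_of_exists_lt ht
      (by fun_prop) (by fun_prop) (fun s hs => ?_) ⟨t, Set.right_mem_Icc.2 ht.le, ?_⟩
    · have := hs.1
      refine Real.exp_le_exp.2 ?_
      have : 0 ≤ σ * s := by positivity
      linarith
    · refine Real.exp_lt_exp.2 ?_
      have : 0 < σ * t := by positivity
      linarith
  have hpos : 0 < Real.exp (2 * v₀) * Real.exp (t / 2) := by positivity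
  have := mul_lt_mul_of_pos_left hlt hpos
  rw [show (1 : ℝ) ^ 2 * t / 2 = t / 2 by ring] at h2
  linarith

/-! ### Strict Jensen inequality for the logarithm -/

/-- Jensen's inequality for the logarithm is strict unless the variable is almost surely equal to
its mean. -/
lemma integral_log_one_add_lt {Ω : Type*} [MeasurableSpace Ω] {P : Measure Ω}
    [IsProbabilityMeasure P] {X : Ω → ℝ} {c : ℝ} (hc : 0 < c) (hX : Integrable X P)
    (hpos : ∀ ω, 0 ≤ X ω) (hne : ¬ ∀ᵐ ω ∂P, X ω = ∫ ω, X ω ∂P) :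
    Integrable (fun ω => Real.log (1 + c * X ω)) P ∧
      ∫ ω, Real.log (1 + c * X ω) ∂P < Real.log (1 + c * ∫ ω, X ω ∂P) := by
  set m := ∫ ω, X ω ∂P with hm
  have hm0 : 0 ≤ m := integral_nonneg hpos
  have hm1 : 0 < 1 + c * m := by positivity
  have h1 (ω : Ω) : 0 < 1 + c * X ω := by have := hpos ω; positivity
  have hint : Integrable (fun ω => Real.log (1 + c * X ω)) P := by
    refine (hX.const_mul c).mono' ?_ (.of_forall fun ω => ?_)
    · exact (Real.measurable_log.comp_aemeasurable
        ((hX.1.aemeasurable.const_mul c).const_add 1)).aestronglyMeasurable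
    · have h0 : 0 ≤ c * X ω := mul_nonneg hc.le (hpos ω)
      rw [Real.norm_of_nonneg (Real.log_nonneg (by linarith))]
      have := Real.log_le_sub_one_of_pos (h1 ω)
      linarith
  refine ⟨hint, ?_⟩
  -- the tangent of the logarithm at the mean, minus the logarithm
  set D : Ω → ℝ := fun ω =>
    Real.log (1 + c * m) + c / (1 + c * m) * (X ω - m) - Real.log (1 + c * X ω) with hD
  have hDeq (ω : Ω) : D ω = (1 + c * X ω) / (1 + c * m) - 1 -
      Real.log ((1 + c * X ω) / (1 + c * m)) := by
    rw [Real.log_div (h1 ω).ne' hm1.ne']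
    simp only [hD]
    field_simp
    ring
  have hD0 : 0 ≤ D := fun ω => by
    rw [Pi.zero_apply, hDeq, sub_nonneg]
    exact Real.log_le_sub_one_of_pos (div_pos (h1 ω) hm1)
  have hdev : Integrable (fun ω => c / (1 + c * m) * (X ω - m)) P :=
    (hX.sub (integrable_const m)).const_mul _
  have hlin : Integrable (fun ω => Real.log (1 + c * m) + c / (1 + c * m) * (X ω - m)) P :=
    (integrable_const _).add hdev
  have hDint : Integrable D P := hlin.sub hint
  have hDval : ∫ ω, D ω ∂P = Real.log (1 + c * m) - ∫ ω, Real.log (1 + c * X ω) ∂P := by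
    simp only [hD]
    rw [integral_sub hlin hint, integral_add (integrable_const _) hdev, integral_const_mul,
      integral_sub hX (integrable_const m), ← hm]
    simp
  have hDpos : 0 < ∫ ω, D ω ∂P := by
    refine (integral_nonneg hD0).lt_of_ne fun h => hne ?_
    have hz := (integral_eq_zero_iff_of_nonneg hD0 hDint).1 h.symm
    filter_upwards [hz] with ω hω
    by_contra hXm
    have hq : (1 + c * X ω) / (1 + c * m) ≠ 1 := by
      rw [Ne, div_eq_one_iff_eq hm1.ne']
      intro hh
      exact hXm (mul_left_cancel₀ hc.ne' (add_left_cancel hh))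
    have := Real.log_lt_sub_one_of_pos (div_pos (h1 ω) hm1) hq
    rw [hDeq, Pi.zero_apply] at hω
    linarith
  linarith

/-! ### The variance swap -/

/-- The explicit solution of the equation, and its integrated variance, in terms of the exponential
functional of Brownian motion. -/
lemma IsLogVolSolution.explicit {Ω : Type*} [MeasurableSpace Ω] {P : Measure Ω}
    {a b σ v₀ : ℝ} {w v : ℝ≥0 → Ω → ℝ} (hb : 0 < b) (hv : IsLogVolSolution P 2 a b σ v₀ w v) :
    ∀ᵐ ω ∂P, ∀ t : ℝ, 0 ≤ t →
      (∫ s in (0 : ℝ)..t, instVar v s.toNNReal ω) =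
          Real.log (1 + 2 * b * expFunctional a σ v₀ w t ω) / (2 * b) ∧
        v t.toNNReal ω = freeLogVol a σ v₀ w t ω -
          Real.log (1 + 2 * b * expFunctional a σ v₀ w t ω) / 2 := by
  filter_upwards [hv] with ω hω t ht
  obtain ⟨h1, h2⟩ := exp_integral_eq hω.1 hω.2 ht
  have h3 : (∫ s in (0 : ℝ)..t, Real.exp (2 * v s.toNNReal ω)) =
      Real.log (1 + 2 * b * expFunctional a σ v₀ w t ω) / (2 * b) := by
    unfold expFunctional freeLogVol
    rw [← h1, Real.log_exp]
    field_simp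
  refine ⟨h3, ?_⟩
  rw [h2, h3, freeLogVol]
  field_simp

/-- The variance is integrable at each time and jointly in time and randomness. -/
lemma IsLogVolSolution.integrable {Ω : Type*} [MeasurableSpace Ω] {P : Measure Ω}
    [IsProbabilityMeasure P] {a b σ v₀ : ℝ} {w v : ℝ≥0 → Ω → ℝ} (hb : 0 < b)
    (hw : IsBrownianReal w P) (hv : IsLogVolSolution P 2 a b σ v₀ w v) :
    (∀ s, Integrable (instVar v s) P) ∧
      ∀ t : ℝ, 0 ≤ t → Integrable (fun q : ℝ × Ω => instVar v q.1.toNNReal q.2)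
        ((volume.restrict (Set.Ioc 0 t)).prod P) := by
  have hexp := hv.explicit hb
  have hvm (s : ℝ≥0) : AEMeasurable (v s) P := by
    have h1 : AEMeasurable (fun ω => freeLogVol a σ v₀ w s ω -
        Real.log (1 + 2 * b * expFunctional a σ v₀ w s ω) / 2) P := by
      refine AEMeasurable.sub ?_ (AEMeasurable.div_const ?_ 2)
      · exact ((hw.aemeasurable _).const_mul σ).const_add _
      · exact Real.measurable_log.comp_aemeasurable
          (((expFunctional_mean hw a σ v₀ s.coe_nonneg).1.1.aemeasurable.const_mul _).const_add 1)
    refine h1.congr ?_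
    filter_upwards [hexp] with ω hω
    rw [← (hω s s.coe_nonneg).2, Real.toNNReal_coe]
  -- mean reversion only lowers the variance
  have hle : ∀ᵐ ω ∂P, ∀ s : ℝ, 0 ≤ s →
      ‖instVar v s.toNNReal ω‖ ≤ Real.exp (2 * freeLogVol a σ v₀ w s ω) := by
    filter_upwards [hexp] with ω hω s hs
    have h0 := expFunctional_nonneg a σ v₀ w hs ω
    have h1 : 0 ≤ Real.log (1 + 2 * b * expFunctional a σ v₀ w s ω) :=
      Real.log_nonneg (by have : 0 ≤ 2 * b * expFunctional a σ v₀ w s ω := by positivity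
                          linarith)
    rw [instVar, Real.norm_of_nonneg (Real.exp_pos _).le, (hω s hs).2]
    exact Real.exp_le_exp.2 (by linarith)
  constructor
  · intro s
    have h1 := (exp_freeLogVol_moment hw.toIsPreBrownianReal a σ v₀ 2 0 s.coe_nonneg le_rfl).1
    simp only [zero_mul, Real.exp_zero, mul_one] at h1
    refine h1.mono' (Real.measurable_exp.comp_aemeasurable
      ((hvm s).const_mul 2)).aestronglyMeasurable ?_
    filter_upwards [hle] with ω hω
    simpa only [Real.toNNReal_coe] using hω s s.coe_nonneg
  · intro t ht
    have h1 := (integral_exp_freeLogVol hw a σ v₀ 2 0 ht).1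
    simp only [zero_mul, Real.exp_zero, mul_one] at h1
    refine h1.mono' (Real.continuous_exp.comp_aestronglyMeasurable
      ((aestronglyMeasurable_uncurry_of_continuous hvm (hv.mono fun ω h => h.1) _).const_mul 2)) ?_
    have hpos : ∀ᵐ q ∂((volume.restrict (Set.Ioc 0 t)).prod P), q.1 ∈ Set.Ioc (0 : ℝ) t :=
      Measure.quasiMeasurePreserving_fst.ae (ae_restrict_mem measurableSet_Ioc)
    filter_upwards [Measure.quasiMeasurePreserving_snd.ae hle, hpos] with q h2 h3
    exact h2 q.1 h3.1.le

/-- The variance swap is the mean of `ln (1 + 2b ∫₀ᵗ e^{2 (v₀ + a s + σ w_s)} ds) / (2bt)`. -/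
lemma IsLogVolSolution.varSwap_eq {Ω : Type*} [MeasurableSpace Ω] {P : Measure Ω}
    [IsProbabilityMeasure P] {a b σ v₀ : ℝ} {w v : ℝ≥0 → Ω → ℝ} (hb : 0 < b)
    (hw : IsBrownianReal w P) (hv : IsLogVolSolution P 2 a b σ v₀ w v) {t : ℝ} (ht : 0 < t) :
    varSwap P v t =
      1 / (2 * b * t) * ∫ ω, Real.log (1 + 2 * b * expFunctional a σ v₀ w t ω) ∂P := by
  have h := (integral_intervalIntegral_swap (X := fun s ω => instVar v s.toNNReal ω) ht.le
    ((hv.integrable hb hw).2 t ht.le)).2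
  rw [varSwap]
  simp only [meanVar]
  rw [← h]
  have h2 : ∫ ω, (∫ s in (0 : ℝ)..t, instVar v s.toNNReal ω) ∂P =
      ∫ ω, Real.log (1 + 2 * b * expFunctional a σ v₀ w t ω) / (2 * b) ∂P := by
    refine integral_congr_ae ?_
    filter_upwards [hv.explicit hb] with ω hω using (hω t ht.le).1
  rw [h2, integral_div]
  field_simp

/-- The first two moments of the exponential functional bound the variance swap from below. -/
lemma IsLogVolSolution.le_varSwap {Ω : Type*} [MeasurableSpace Ω] {P : Measure Ω}
    [IsProbabilityMeasure P] {a b σ v₀ : ℝ} {w v : ℝ≥0 → Ω → ℝ} (hb : 0 < b)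
    (hw : IsBrownianReal w P) (hv : IsLogVolSolution P 2 a b σ v₀ w v) {t : ℝ} (ht : 0 < t) :
    (Real.exp (2 * v₀) * expQuot (2 * a + 2 * σ ^ 2) t -
        b * t * Real.exp (2 * v₀) ^ 2 * expQuot (4 * a + 8 * σ ^ 2) t) / t ≤ varSwap P v t := by
  obtain ⟨h1, h2⟩ := expFunctional_mean hw a σ v₀ ht.le
  obtain ⟨h3, h4⟩ := expFunctional_sq_mean_le hw a σ v₀ ht
  have hJ (ω : Ω) : 0 ≤ 2 * b * expFunctional a σ v₀ w t ω := by
    have := expFunctional_nonneg a σ v₀ w ht.le ω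
    positivity
  have hlog : Integrable (fun ω => Real.log (1 + 2 * b * expFunctional a σ v₀ w t ω)) P := by
    refine (h1.const_mul (2 * b)).mono' (Real.measurable_log.comp_aemeasurable
      ((h1.1.aemeasurable.const_mul _).const_add 1)).aestronglyMeasurable (.of_forall fun ω => ?_)
    rw [Real.norm_of_nonneg (Real.log_nonneg (by linarith [hJ ω]))]
    have := Real.log_le_sub_one_of_pos (x := 1 + 2 * b * expFunctional a σ v₀ w t ω)
      (by linarith [hJ ω])
    linarith
  have hmono : ∫ ω, (2 * b * expFunctional a σ v₀ w t ω -
      2 * b ^ 2 * expFunctional a σ v₀ w t ω ^ 2) ∂P ≤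
      ∫ ω, Real.log (1 + 2 * b * expFunctional a σ v₀ w t ω) ∂P := by
    refine integral_mono ((h1.const_mul _).sub (h3.const_mul _)) hlog fun ω => ?_
    have := log_one_add_ge (hJ ω)
    simp only
    refine le_trans (le_of_eq ?_) this
    ring
  rw [integral_sub (h1.const_mul _) (h3.const_mul _), integral_const_mul, integral_const_mul,
    h2] at hmono
  rw [hv.varSwap_eq hb hw ht, div_le_iff₀ ht]
  have hbt : 1 / (2 * b * t) * (∫ ω, Real.log (1 + 2 * b * expFunctional a σ v₀ w t ω) ∂P) * t =
      (∫ ω, Real.log (1 + 2 * b * expFunctional a σ v₀ w t ω) ∂P) / (2 * b) := by field_simp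
  rw [hbt, le_div_iff₀ (by positivity)]
  have := mul_le_mul_of_nonneg_left h4 (show 0 ≤ 2 * b ^ 2 by positivity)
  linarith

/-- The cubic upper Taylor bound of the logarithm, applied to `f`. -/
lemma swapBound_le {a b σ V₀ t : ℝ} (hb : 0 < b) (hV : 0 < V₀) (ht : 0 < t) :
    swapBound a b σ V₀ t ≤ (V₀ * expQuot (2 * a + 2 * σ ^ 2) t -
      b * V₀ ^ 2 * expQuot (2 * a + 2 * σ ^ 2) t ^ 2 +
      4 / 3 * b ^ 2 * V₀ ^ 3 * expQuot (2 * a + 2 * σ ^ 2) t ^ 3) / t := by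
  have hq := expQuot_pos (2 * a + 2 * σ ^ 2) ht
  have h := log_one_add_le (u := 2 * b * V₀ * expQuot (2 * a + 2 * σ ^ 2) t) (by positivity)
  refine (mul_le_mul_of_nonneg_left h (by positivity)).trans_eq ?_
  field_simp
  ring

/-! ### Small-time asymptotics -/

lemma isLittleO_of_tendsto_div {F : ℝ → ℝ} (h : Tendsto (fun t => F t / t) (𝓝[>] 0) (𝓝 0)) :
    F =o[𝓝[>] 0] (fun t : ℝ => t) :=
  (isLittleO_iff_tendsto' (eventually_mem_nhdsWithin.mono fun _ ht h0 =>
    absurd h0 (ne_of_gt ht))).2 h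

/-- Any function between the moment lower bound for the variance swap and the cubic upper bound for
`f` has the same first-order expansion. -/
lemma isLittleO_sub_firstOrder {a b σ V₀ : ℝ} {F : ℝ → ℝ}
    (hl : ∀ t : ℝ, 0 < t → (V₀ * expQuot (2 * a + 2 * σ ^ 2) t -
        b * t * V₀ ^ 2 * expQuot (4 * a + 8 * σ ^ 2) t) / t ≤ F t)
    (hu : ∀ t : ℝ, 0 < t → F t ≤ (V₀ * expQuot (2 * a + 2 * σ ^ 2) t -
      b * V₀ ^ 2 * expQuot (2 * a + 2 * σ ^ 2) t ^ 2 +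
      4 / 3 * b ^ 2 * V₀ ^ 3 * expQuot (2 * a + 2 * σ ^ 2) t ^ 3) / t) :
    (fun t => F t - firstOrder a b σ V₀ t) =o[𝓝[>] (0 : ℝ)] (fun t : ℝ => t) := by
  set q := expQuot (2 * a + 2 * σ ^ 2) with hq
  set r := expQuot (4 * a + 8 * σ ^ 2) with hr
  have h0 : Tendsto (fun t : ℝ => t) (𝓝[>] 0) (𝓝 0) := nhdsWithin_le_nhds
  have hq2 := tendsto_expQuot_second (2 * a + 2 * σ ^ 2)
  have hq1 := tendsto_expQuot_first (2 * a + 2 * σ ^ 2)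
  have hr1 := tendsto_expQuot_first (4 * a + 8 * σ ^ 2)
  rw [← hq] at hq1 hq2
  rw [← hr] at hr1
  have hlow : Tendsto (fun t => V₀ * ((q t - t) / t ^ 2 - (2 * a + 2 * σ ^ 2) / 2) -
      b * V₀ ^ 2 * (r t / t - 1)) (𝓝[>] 0) (𝓝 0) := by
    have := ((hq2.sub_const ((2 * a + 2 * σ ^ 2) / 2)).const_mul V₀).sub
      ((hr1.sub_const 1).const_mul (b * V₀ ^ 2))
    simpa using this
  have hupp : Tendsto (fun t => V₀ * ((q t - t) / t ^ 2 - (2 * a + 2 * σ ^ 2) / 2) -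
      b * V₀ ^ 2 * ((q t / t) ^ 2 - 1) + 4 / 3 * b ^ 2 * V₀ ^ 3 * ((q t / t) ^ 3 * t))
      (𝓝[>] 0) (𝓝 0) := by
    have := (((hq2.sub_const ((2 * a + 2 * σ ^ 2) / 2)).const_mul V₀).sub
      (((hq1.pow 2).sub_const 1).const_mul (b * V₀ ^ 2))).add
      (((hq1.pow 3).mul h0).const_mul (4 / 3 * b ^ 2 * V₀ ^ 3))
    simpa using this
  refine isLittleO_of_tendsto_div (tendsto_of_tendsto_of_tendsto_of_le_of_le' hlow hupp ?_ ?_)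
  · filter_upwards [self_mem_nhdsWithin] with t ht
    have ht' : 0 < t := ht
    rw [le_div_iff₀ ht']
    refine le_trans (le_of_eq ?_) (sub_le_sub_right (hl t ht) _)
    rw [firstOrder]
    field_simp
    ring
  · filter_upwards [self_mem_nhdsWithin] with t ht
    have ht' : 0 < t := ht
    rw [div_le_iff₀ ht']
    refine (sub_le_sub_right (hu t ht) _).trans_eq ?_
    rw [firstOrder]
    field_simp
    ring

end AlphaHypergeometric

theorem proposition4 {Ω : Type*} [MeasurableSpace Ω] (P : Measure Ω) [IsProbabilityMeasure P]
    (a b σ v₀ V₀ : ℝ) (hb : 0 < b) (hσ : 0 < σ) (hV₀ : V₀ = Real.exp (2 * v₀))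
    (w v : ℝ≥0 → Ω → ℝ) (hw : IsBrownianReal w P)
    (hv : AlphaHypergeometric.IsLogVolSolution P 2 a b σ v₀ w v) :
    -- the expectations and the time integral that define the variance swap are finite
    (∀ s : ℝ≥0, Integrable (AlphaHypergeometric.instVar v s) P) ∧
    (∀ t : ℝ, 0 < t → IntervalIntegrable (AlphaHypergeometric.meanVar P v) volume 0 t) ∧
    -- the upper bound
    (∀ t : ℝ, 0 < t →
      AlphaHypergeometric.varSwap P v t < AlphaHypergeometric.swapBound a b σ V₀ t) ∧
    -- the equivalences as `t → 0+`: the ratios tend to one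
    (AlphaHypergeometric.varSwap P v ~[𝓝[>] (0 : ℝ)] AlphaHypergeometric.swapBound a b σ V₀) ∧
    (AlphaHypergeometric.swapBound a b σ V₀ ~[𝓝[>] (0 : ℝ)]
      AlphaHypergeometric.firstOrder a b σ V₀) ∧
    -- moreover all three functions agree up to an error `o(t)`
    ((fun t => AlphaHypergeometric.varSwap P v t - AlphaHypergeometric.swapBound a b σ V₀ t)
      =o[𝓝[>] (0 : ℝ)] (fun t : ℝ => t)) ∧
    ((fun t => AlphaHypergeometric.swapBound a b σ V₀ t -
        AlphaHypergeometric.firstOrder a b σ V₀ t)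
      =o[𝓝[>] (0 : ℝ)] (fun t : ℝ => t)) := by

  have hV : 0 < V₀ := hV₀ ▸ Real.exp_pos _
  have hlt : ∀ t : ℝ, 0 < t →
      AlphaHypergeometric.varSwap P v t < AlphaHypergeometric.swapBound a b σ V₀ t := by
    intro t ht
    obtain ⟨h1, h2⟩ := AlphaHypergeometric.expFunctional_mean hw a σ v₀ ht.le
    have hne := AlphaHypergeometric.not_expFunctional_ae_eq_mean hw a v₀ hσ ht
    rw [← h2] at hne
    have h3 := (AlphaHypergeometric.integral_log_one_add_lt (c := 2 * b) (by positivity) h1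
      (AlphaHypergeometric.expFunctional_nonneg a σ v₀ w ht.le) hne).2
    rw [hv.varSwap_eq hb hw ht, AlphaHypergeometric.swapBound]
    rw [h2, ← hV₀, ← mul_assoc] at h3
    exact mul_lt_mul_of_pos_left h3 (by positivity)
  have hlow := fun (t : ℝ) (ht : 0 < t) => hv.le_varSwap hb hw ht
  rw [← hV₀] at hlow
  have hupp := fun (t : ℝ) (ht : 0 < t) =>
    AlphaHypergeometric.swapBound_le (a := a) (σ := σ) hb hV ht
  have hvs := AlphaHypergeometric.isLittleO_sub_firstOrder hlow
    fun t ht => (hlt t ht).le.trans (hupp t ht)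
  have hf := AlphaHypergeometric.isLittleO_sub_firstOrder
    (fun t ht => (hlow t ht).trans (hlt t ht).le) hupp
  -- the common first-order expansion is bounded away from zero, so that errors `o(t)` are relative
  have hfo : Tendsto (AlphaHypergeometric.firstOrder a b σ V₀) (𝓝[>] 0) (𝓝 V₀) := by
    have hc : Continuous (AlphaHypergeometric.firstOrder a b σ V₀) := by
      unfold AlphaHypergeometric.firstOrder
      fun_prop
    have := hc.tendsto 0
    rw [show AlphaHypergeometric.firstOrder a b σ V₀ 0 = V₀ by
      simp [AlphaHypergeometric.firstOrder]] at this
    exact this.mono_left nhdsWithin_le_nhds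
  have hO : (fun t : ℝ => t) =O[𝓝[>] 0] AlphaHypergeometric.firstOrder a b σ V₀ := by
    have h1 : (fun t : ℝ => t) =O[𝓝[>] 0] (fun _ => (1 : ℝ)) :=
      (show Tendsto (fun t : ℝ => t) (𝓝[>] 0) (𝓝 0) from nhdsWithin_le_nhds).isBigO_one ℝ
    exact h1.trans ((isBigO_const_left_iff_pos_le_norm one_ne_zero).2 ⟨V₀ / 2, by positivity, by
      filter_upwards [hfo.eventually (lt_mem_nhds (half_lt_self hV))] with t ht
      exact ht.le.trans (le_abs_self _)⟩)
  have hvs' : AlphaHypergeometric.varSwap P v ~[𝓝[>] (0 : ℝ)]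
      AlphaHypergeometric.firstOrder a b σ V₀ := hvs.trans_isBigO hO
  have hf' : AlphaHypergeometric.swapBound a b σ V₀ ~[𝓝[>] (0 : ℝ)]
      AlphaHypergeometric.firstOrder a b σ V₀ := hf.trans_isBigO hO
  refine ⟨(hv.integrable hb hw).1, fun t ht => ?_, hlt, hvs'.trans hf'.symm, hf', ?_, hf⟩
  · rw [intervalIntegrable_iff_integrableOn_Ioc_of_le ht.le]
    exact ((hv.integrable hb hw).2 t ht.le).integral_prod_left
  · exact (hvs.sub hf).congr_left fun t => by ring
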